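/- Let $\mathbb{D}=\{z\in\mathbb{C}:|z|<1\}$. For a harmonic mapping $f:\mathbb{D}\to\mathbb{C}$ (real and imaginary parts harmonic) put $$\Lambda_f=|f_z|+|f_{\bar z}|,\qquad \lambda_f=\bigl||f_z|-|f_{\bar z}|\bigr|,\qquad J_f=|f_z|^2-|f_{\bar z}|^2,$$ $$l_f(r)=r\int_0^{2\pi}\bigl|f_z(re^{i\theta})-e^{-2i\theta}f_{\bar z}(re^{i\theta})\bigr|\,d\theta\quad(0<r<1),\qquad l_f(1)=\sup_{0<r<1}l_f(r),$$ $$\beta_f=\sup_{z,w\in\mathbb{D},\,z\ne w}\frac{|f(z)-f(w)|}{\rho(z,w)},\qquad \rho(z,w)=\operatorname{arctanh}\left|\frac{z-w}{1-\bar z w}\right| ,$$ and call $f$ a harmonic Bloch mapping if $\beta_f<\infty$. For $K\in[1,\infty)$, $f$ is called a sense-preserving $K$-quasiconformal harmonic mapping of $\mathbb{D}$ if $f$ is harmonic and injective in $\mathbb{D}$, with $J_f>0$ and $\Lambda_f\le K\lambda_f$ in $\mathbb{D}$. **Theorem.** Let $f(z)=\sum_{n=0}^\infty a_nz^n+\sum_{n=1}^\infty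 \bar b_n\bar z^n$ be a sense-preserving $K$-quasiconformal harmonic mapping of $\mathbb{D}$ with $l_f(1)<\infty$. Then $$|a_n|+|b_n|\le\frac{K\,l_f(1)}{2n\pi}\quad(n\ge1)\qquad\text{and}\qquad \Lambda_f(z)\le\frac{l_f(1)\sqrt K}{2\pi(1-|z|)}\quad(z\in\mathbb{D}).$$ Moreover, $f$ is a harmonic Bloch mapping and $\beta_f\le l_f(1)\sqrt K/\pi$. If $K=1$, the first two estimates are sharp: the function $f(z)=z$ satisfies the hypotheses with $K=1$ and attains equality in the first estimate for $n=1$ and in the second one at $z=0$. -/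

import Mathlib

noncomputable section

namespace PlanarHarmonic

open scoped ENNReal ComplexConjugate

/-- The open unit disk. -/
def unitDisk : Set ℂ := Metric.ball 0 1

/-- The Wirtinger derivative `f_z = (f_x - i f_y) / 2`. -/
def dz (f : ℂ → ℂ) (z : ℂ) : ℂ :=
  (fderiv ℝ f z 1 - Complex.I * fderiv ℝ f z Complex.I) / 2

/-- The Wirtinger derivative `f_{z̄} = (f_x + i f_y) / 2`. -/
def dzbar (f : ℂ → ℂ) (z : ℂ) : ℂ :=
  (fderiv ℝ f z 1 + Complex.I * fderiv ℝ f z Complex.I) / 2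

/-- `Λ_f(z) = |f_z(z)| + |f_{z̄}(z)|`. -/
def bigLambda (f : ℂ → ℂ) (z : ℂ) : ℝ := ‖dz f z‖ + ‖dzbar f z‖

/-- `λ_f(z) = | |f_z(z)| - |f_{z̄}(z)| |`. -/
def smallLambda (f : ℂ → ℂ) (z : ℂ) : ℝ := |‖dz f z‖ - ‖dzbar f z‖|

/-- The Jacobian `J_f = |f_z|² - |f_{z̄}|²`. -/
def jacobian (f : ℂ → ℂ) (z : ℂ) : ℝ := ‖dz f z‖ ^ 2 - ‖dzbar f z‖ ^ 2

/-- A harmonic mapping of the unit disk: the real and imaginary parts are harmonic. -/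
def IsHarmonicMapping (f : ℂ → ℂ) : Prop :=
  InnerProductSpace.HarmonicOnNhd (fun z => (f z).re) unitDisk ∧
    InnerProductSpace.HarmonicOnNhd (fun z => (f z).im) unitDisk

/-- Positive Jacobian, i.e. locally univalent and sense-preserving in the disk. -/
def IsSensePreserving (f : ℂ → ℂ) : Prop := ∀ z ∈ unitDisk, 0 < jacobian f z

/-- A sense-preserving `K`-quasiconformal harmonic mapping of the unit disk, `K ∈ [1, ∞)`. -/
structure IsQuasiconformalHarmonic (K : ℝ) (f : ℂ → ℂ) : Prop where
  one_le : 1 ≤ K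
  harmonic : IsHarmonicMapping f
  sensePreserving : IsSensePreserving f
  quasiregular : ∀ z ∈ unitDisk, bigLambda f z ≤ K * smallLambda f z
  univalent : Set.InjOn f unitDisk

/-- The expansion `f(z) = ∑_{n ≥ 0} a_n zⁿ + ∑_{n ≥ 1} conj(b_n) conj(z)ⁿ` on the unit disk,
both series being convergent there (the second sum is indexed by `n + 1`, so `b 0` is unused). -/
def HasHarmonicExpansion (f : ℂ → ℂ) (a b : ℕ → ℂ) : Prop :=
  ∀ z ∈ unitDisk,
    Summable (fun n : ℕ => a n * z ^ n) ∧
    Summable (fun n : ℕ => conj (b (n + 1)) * conj z ^ (n + 1)) ∧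
    f z = (∑' n : ℕ, a n * z ^ n) + ∑' n : ℕ, conj (b (n + 1)) * conj z ^ (n + 1)

/-- The length, counting multiplicity, of the image of the circle of radius `r`:
`l_f(r) = r ∫_0^{2π} |f_z(r e^{iθ}) - e^{-2iθ} f_{z̄}(r e^{iθ})| dθ`. -/
def circleLength (f : ℂ → ℂ) (r : ℝ) : ℝ :=
  r * ∫ θ in (0 : ℝ)..(2 * Real.pi),
    ‖dz f (r * Complex.exp (θ * Complex.I)) -
      Complex.exp (-2 * θ * Complex.I) * dzbar f (r * Complex.exp (θ * Complex.I))‖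

/-- `l_f(1) = sup_{0 < r < 1} l_f(r)`, possibly infinite. -/
def boundaryLength (f : ℂ → ℂ) : ℝ≥0∞ :=
  ⨆ r ∈ Set.Ioo (0 : ℝ) 1, ENNReal.ofReal (circleLength f r)

/-- The hyperbolic distance of the unit disk, `arctanh |(z - w) / (1 - conj(z) w)|`. -/
def hypDist (z w : ℂ) : ℝ :=
  1 / 2 * Real.log ((1 + ‖(z - w) / (1 - conj z * w)‖) / (1 - ‖(z - w) / (1 - conj z * w)‖))

/-- The Lipschitz number `β_f = sup_{z ≠ w} |f(z) - f(w)| / ρ(z, w)`, possibly infinite. -/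
def lipschitzNumber (f : ℂ → ℂ) : ℝ≥0∞ :=
  ⨆ (z ∈ unitDisk) (w ∈ unitDisk) (_ : z ≠ w), ENNReal.ofReal (‖f z - f w‖ / hypDist z w)

/-- Harmonic Bloch mappings: harmonic mappings of the disk with finite Lipschitz number. -/
def IsHarmonicBloch (f : ℂ → ℂ) : Prop := IsHarmonicMapping f ∧ lipschitzNumber f < ∞

end PlanarHarmonic

end

noncomputable section

namespace PlanarHarmonic

open scoped ENNReal ComplexConjugate
open MeasureTheory

/-! Both pointwise estimates come from testing `f` against one holomorphic function. Since `f` is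
harmonic, `f_z` and the conjugate of `f_{z̄}` are holomorphic, and hence so is `f_z + c * conj
f_{z̄}` for any constant `c`. When `|c| = 1` its modulus is at most `Λ_f`, and `c` can be rotated so
that no triangle inequality is lost at a given point or at a given Taylor coefficient.

For the coefficients, Cauchy's estimate bounds `n |a_n + c b_n| r^(n-1)` by the circular mean of
`Λ_f`. Quasiconformality and the reverse triangle inequality bound `Λ_f` by `K` times the integrand
of `l_f(r)`; then `r → 1` (`IsQuasiconformalHarmonic.norm_coeff_add_le`).

For `Λ_f`, the area mean value property of the squared test function on a disk of radius `s` about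
`z`, together with `Λ_f² ≤ K J_f`, bounds `π s² Λ_f(z)²` by `K` times the area, with multiplicity,
of the image of a larger disk centred at `0`. The isoperimetric inequality bounds that area by
`l_f(1)² / (4π)` (`setIntegral_jacobian_le`); then `s → 1 - |z|`. The inequality is needed for
closed curves that may cross themselves. It follows from Fourier series (Wirtinger's inequality) and
Green's theorem in polar coordinates.

Integrating the bound on `Λ_f` along hyperbolic geodesics gives the Bloch estimate
(`norm_sub_le_mul_hypDist`). -/

/-! ### Wirtinger's inequality and the isoperimetric inequality. -/

/-- **Wirtinger's inequality** for closed curves with mean zero. -/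
theorem integral_norm_sq_le_of_integral_eq_zero {L : ℝ} (hL : 0 < L) {G G' : ℝ → ℂ}
    (hG : ∀ x, HasDerivAt G (G' x) x) (hG' : Continuous G') (hper : G L = G 0)
    (hmean : ∫ x in (0 : ℝ)..L, G x = 0) :
    ∫ x in (0 : ℝ)..L, ‖G x‖ ^ 2 ≤
      (L / (2 * Real.pi)) ^ 2 * ∫ x in (0 : ℝ)..L, ‖G' x‖ ^ 2 := by
  have hGc : Continuous G := continuous_iff_continuousAt.2 fun x => (hG x).continuousAt
  have memLp : ∀ u : ℝ → ℂ, Continuous u → MemLp u 2 (volume.restrict (Set.Ioc 0 L)) := by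
    intro u hu
    obtain ⟨M, hM⟩ := (isCompact_Icc (a := (0 : ℝ)) (b := L)).exists_bound_of_continuousOn
      hu.continuousOn
    refine MemLp.of_bound hu.aestronglyMeasurable M ?_
    filter_upwards [ae_restrict_mem measurableSet_Ioc] with x hx
    exact hM x (Set.Ioc_subset_Icc_self hx)
  -- Parseval reduces the claim to single coefficients. Integration by parts gives the `n`-th
  -- coefficient of `G` the modulus `L / (2π|n|)` times that of `G'` for `n ≠ 0`; the zeroth
  -- vanishes by the mean condition.
  have h1 := hasSum_sq_fourierCoeffOn hL (memLp G hGc)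
  have h2 := (hasSum_sq_fourierCoeffOn hL (memLp G' hG')).mul_left ((L / (2 * Real.pi)) ^ 2)
  have hle := hasSum_le (fun n : ℤ => ?_) h1 h2
  · simp only [smul_eq_mul, sub_zero] at hle
    have : L⁻¹ * ∫ x in (0 : ℝ)..L, ‖G x‖ ^ 2 ≤ L⁻¹ * ((L / (2 * Real.pi)) ^ 2 *
        ∫ x in (0 : ℝ)..L, ‖G' x‖ ^ 2) := by linarith
    exact le_of_mul_le_mul_left this (by positivity)
  rcases eq_or_ne n 0 with rfl | hn
  · rw [fourierCoeffOn_eq_integral]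
    simp [hmean]
    positivity
  · rw [fourierCoeffOn_of_hasDerivAt hL hn (fun x _ => hG x) (hG'.intervalIntegrable _ _), hper]
    simp only [sub_self, mul_zero, zero_sub, sub_zero, norm_mul, norm_div, norm_one, norm_neg,
      Complex.ofReal_zero]
    have h1n : (1 : ℝ) ≤ |(n : ℝ)| := by exact_mod_cast Int.one_le_abs hn
    have hpi := Real.pi_pos
    simp only [Complex.norm_real, Complex.norm_I, Complex.norm_intCast, Complex.norm_ofNat,
      Real.norm_eq_abs, abs_of_pos hL, abs_of_pos hpi]
    rw [← mul_assoc, mul_pow]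
    gcongr
    rw [div_mul_eq_mul_div, one_mul, mul_one]
    exact div_le_div_of_nonneg_left hL.le (by positivity)
      (le_mul_of_one_le_right (by positivity) h1n)

/-- The isoperimetric inequality for closed curves of constant speed one. -/
theorem integral_conj_mul_deriv_im_le_of_norm_deriv_eq_one {L : ℝ} (hL : 0 < L) {G G' : ℝ → ℂ}
    (hG : ∀ x, HasDerivAt G (G' x) x) (hG' : Continuous G') (hper : G L = G 0)
    (hspeed : ∀ x, ‖G' x‖ = 1) :
    ∫ x in (0 : ℝ)..L, (conj (G x) * G' x).im ≤ L ^ 2 / (2 * Real.pi) := by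
  have hGc : Continuous G := continuous_iff_continuousAt.2 fun x => (hG x).continuousAt
  have hpi := Real.pi_pos
  -- Translating the curve to have mean zero does not change its signed area, because `G'`
  -- integrates to `0`.
  set c : ℂ := (L : ℂ)⁻¹ * ∫ x in (0 : ℝ)..L, G x with hc
  have hLc : (L : ℂ) ≠ 0 := by exact_mod_cast hL.ne'
  have hmean : ∫ x in (0 : ℝ)..L, (G x - c) = 0 := by
    rw [intervalIntegral.integral_sub (hGc.intervalIntegrable _ _) (by simp)]
    simp only [intervalIntegral.integral_const, sub_zero, hc, Complex.real_smul]
    field_simp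
    simp
  have hw := integral_norm_sq_le_of_integral_eq_zero hL (G := fun x => G x - c)
    (fun x => (hG x).sub_const c) hG' (by simp [hper]) hmean
  have hzero : ∫ x in (0 : ℝ)..L, (conj c * G' x).im = 0 := by
    have h0 : ∫ x in (0 : ℝ)..L, G' x = 0 := by
      rw [intervalIntegral.integral_eq_sub_of_hasDerivAt (fun x _ => hG x)
        (hG'.intervalIntegrable _ _), hper, sub_self]
    have := Complex.imCLM.intervalIntegral_comp_comm
      ((continuous_const.mul hG').intervalIntegrable (μ := volume) (u := fun x => conj c * G' x) 0 L)
    simp only [Complex.imCLM_apply] at this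
    rw [this, intervalIntegral.integral_const_mul, h0]
    simp
  have hsplit : ∫ x in (0 : ℝ)..L, (conj (G x) * G' x).im
      = ∫ x in (0 : ℝ)..L, (conj (G x - c) * G' x).im := by
    rw [← sub_eq_zero, ← intervalIntegral.integral_sub
      (Continuous.intervalIntegrable (by fun_prop) _ _)
      (Continuous.intervalIntegrable (by fun_prop) _ _), ← hzero]
    congr 1
    ext x
    rw [← Complex.sub_im, map_sub]
    congr 1
    ring
  rw [hsplit]
  -- AM-GM, weighted so that after Wirtinger's inequality each of the two terms contributes at most
  -- `L² / (4π)`.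
  have hpt : ∀ x, (conj (G x - c) * G' x).im ≤
      Real.pi / L * ‖G x - c‖ ^ 2 + L / (4 * Real.pi) := by
    intro x
    refine (Complex.im_le_norm _).trans ?_
    rw [norm_mul, RCLike.norm_conj, hspeed, mul_one]
    have : Real.pi / L * ‖G x - c‖ ^ 2 + L / (4 * Real.pi) - ‖G x - c‖ =
        (2 * Real.pi * ‖G x - c‖ - L) ^ 2 / (4 * Real.pi * L) := by field_simp; ring
    have : 0 ≤ (2 * Real.pi * ‖G x - c‖ - L) ^ 2 / (4 * Real.pi * L) := by positivity
    linarith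
  calc ∫ x in (0 : ℝ)..L, (conj (G x - c) * G' x).im
      ≤ ∫ x in (0 : ℝ)..L, (Real.pi / L * ‖G x - c‖ ^ 2 + L / (4 * Real.pi)) :=
        intervalIntegral.integral_mono_on hL.le (Continuous.intervalIntegrable (by fun_prop) _ _)
          (Continuous.intervalIntegrable (by fun_prop) _ _) fun x _ => hpt x
    _ = Real.pi / L * (∫ x in (0 : ℝ)..L, ‖G x - c‖ ^ 2) + L * (L / (4 * Real.pi)) := by
        rw [intervalIntegral.integral_add (Continuous.intervalIntegrable (by fun_prop) _ _)
          (Continuous.intervalIntegrable (by fun_prop) _ _), intervalIntegral.integral_const_mul]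
        simp [mul_div_assoc]
    _ ≤ Real.pi / L * ((L / (2 * Real.pi)) ^ 2 * L) + L * (L / (4 * Real.pi)) := by
        gcongr
        simpa [hspeed] using hw
    _ = L ^ 2 / (2 * Real.pi) := by field_simp; ring

/-- The **isoperimetric inequality**: for a regular closed curve, twice the signed area is at most
the squared length divided by `2π`. -/
theorem integral_conj_mul_deriv_im_le {T : ℝ} (hT : 0 < T) {F F' : ℝ → ℂ}
    (hF : ∀ x, HasDerivAt F (F' x) x) (hF' : Continuous F') (hne : ∀ x, F' x ≠ 0)
    (hper : Function.Periodic F' T) (hclosed : F T = F 0) :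
    ∫ x in (0 : ℝ)..T, (conj (F x) * F' x).im ≤
      (∫ x in (0 : ℝ)..T, ‖F' x‖) ^ 2 / (2 * Real.pi) := by
  have hFc : Continuous F := continuous_iff_continuousAt.2 fun x => (hF x).continuousAt
  set s : ℝ → ℝ := fun x => ∫ t in (0 : ℝ)..x, ‖F' t‖ with hs
  have hpos : ∀ x, 0 < ‖F' x‖ := fun x => norm_pos_iff.2 (hne x)
  have hsd : ∀ x, HasDerivAt s ‖F' x‖ x := fun x =>
    intervalIntegral.integral_hasDerivAt_right (hF'.norm.intervalIntegrable _ _)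
      (hF'.norm.stronglyMeasurableAtFilter _ _) hF'.norm.continuousAt
  have hmono : StrictMono s := strictMono_of_hasDerivAt_pos hsd hpos
  have hsc : Continuous s := continuous_iff_continuousAt.2 fun x => (hsd x).continuousAt
  -- Positive periodic speed makes the arc length `s` a bijection of the whole line, so its inverse
  -- `ψ` is differentiable everywhere and no endpoint needs separate care.
  have hnper : Function.Periodic (fun x => ‖F' x‖) T := fun x => by simp [hper x]
  have hii : ∀ a b, IntervalIntegrable (fun x => ‖F' x‖) volume a b :=
    fun a b => hF'.norm.intervalIntegrable a b
  have htop := hnper.tendsto_atTop_intervalIntegral_of_pos' (hii 0 T) hpos hT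
  have hbot := hnper.tendsto_atBot_intervalIntegral_of_pos' (hii 0 T) hpos hT
  have hsurj : Function.Surjective s := hsc.surjective htop hbot
  set e := hmono.orderIsoOfSurjective s hsurj with he
  set ψ : ℝ → ℝ := fun y => e.symm y with hψ
  have hψs : ∀ x, ψ (s x) = x := fun x => e.symm_apply_apply x
  have hsψ : ∀ y, s (ψ y) = y := fun y => e.apply_symm_apply y
  have hψc : Continuous ψ := e.symm.continuous
  have hψd : ∀ y, HasDerivAt ψ (‖F' (ψ y)‖)⁻¹ y := fun y =>
    HasDerivAt.of_local_left_inverse hψc.continuousAt (hsd _) (hpos _).ne'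
      (Filter.Eventually.of_forall hsψ)
  have hL : 0 < s T := by
    have := hmono hT
    simpa [hs] using this
  have hs0 : s 0 = 0 := by simp [hs]
  have hψ0 : ψ 0 = 0 := by rw [← hs0, hψs]; exact hs0.symm ▸ rfl
  set G' : ℝ → ℂ := fun y => (‖F' (ψ y)‖)⁻¹ • F' (ψ y) with hG'
  have hGd : ∀ y, HasDerivAt (fun y => F (ψ y)) (G' y) y := fun y =>
    (hF (ψ y)).scomp y (hψd y)
  have hG'c : Continuous G' :=
    Continuous.smul ((hF'.comp hψc).norm.inv₀ fun y => (hpos _).ne') (hF'.comp hψc)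
  have key := integral_conj_mul_deriv_im_le_of_norm_deriv_eq_one hL hGd hG'c
    (by simp only [hψs, hψ0, hclosed]) (fun y => by
      simp only [hG', norm_smul, norm_inv, norm_norm]
      exact inv_mul_cancel₀ (hpos _).ne')
  have hcv := intervalIntegral.integral_comp_mul_deriv (a := 0) (b := T)
    (f := s) (f' := fun x => ‖F' x‖) (g := fun y => (conj (F (ψ y)) * G' y).im)
    (fun x _ => hsd x) hF'.norm.continuousOn (by fun_prop)
  rw [hs0] at hcv
  rw [← hcv] at key
  convert key using 2
  ext x
  simp only [Function.comp_apply, hψs, hG', Complex.real_smul]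
  rw [mul_left_comm, Complex.im_ofReal_mul, mul_comm (‖F' x‖⁻¹), mul_assoc,
    inv_mul_cancel₀ (hpos x).ne', mul_one]

/-! ### Polar coordinates, Green's theorem and the area formula. -/

/-- Integration over a disk in polar coordinates. -/
theorem setIntegral_ball_eq_polar {E : Type*} [NormedAddCommGroup E] [NormedSpace ℝ E]
    {g : ℂ → E} {c : ℂ} {R : ℝ} (hR : 0 ≤ R) (hg : ContinuousOn g (Metric.closedBall c R)) :
    ∫ z in Metric.ball c R, g z =
      ∫ ρ in (0 : ℝ)..R, ∫ θ in (-Real.pi)..Real.pi,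
        ρ • g (c + ρ * Complex.exp (θ * Complex.I)) := by
  have hsymm : ∀ p : ℝ × ℝ, Complex.polarCoord.symm p = p.1 * Complex.exp (p.2 * Complex.I) := by
    intro p
    rw [Complex.polarCoord_symm_apply, Complex.exp_mul_I, Complex.ofReal_cos, Complex.ofReal_sin]
  have h1 : ∫ z in Metric.ball c R, g z =
      ∫ z, (Metric.ball (0 : ℂ) R).indicator (fun z => g (c + z)) z := by
    rw [← integral_indicator measurableSet_ball,
      ← integral_add_left_eq_self (μ := volume) ((Metric.ball c R).indicator g) c]
    congr 1
    ext z
    simp only [Set.indicator, Metric.mem_ball, dist_zero_right, dist_self_add_left]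
  have hset : Complex.polarCoord.target ∩ {p | p.1 < R} =
      Set.Ioo 0 R ×ˢ Set.Ioo (-Real.pi) Real.pi := by
    ext p
    simp only [Complex.polarCoord_target, Set.mem_inter_iff, Set.mem_prod, Set.mem_Ioi,
      Set.mem_Ioo, Set.mem_ofPred_eq]
    tauto
  have hmeas : MeasurableSet {p : ℝ × ℝ | p.1 < R} := measurableSet_lt measurable_fst measurable_const
  have h2 : ∫ p in Complex.polarCoord.target,
      p.1 • (Metric.ball (0 : ℂ) R).indicator (fun z => g (c + z)) (Complex.polarCoord.symm p) =
      ∫ p in Complex.polarCoord.target, {p : ℝ × ℝ | p.1 < R}.indicator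
        (fun p => p.1 • g (c + p.1 * Complex.exp (p.2 * Complex.I))) p := by
    refine setIntegral_congr_fun Complex.polarCoord.open_target.measurableSet fun p hp => ?_
    rw [Complex.polarCoord_target] at hp
    have hnorm : ‖(p.1 : ℂ) * Complex.exp (p.2 * Complex.I)‖ = p.1 := by
      simp [Complex.norm_exp_ofReal_mul_I, abs_of_pos (Set.mem_Ioi.1 hp.1)]
    simp only [Set.indicator, Metric.mem_ball, dist_zero_right, hsymm, hnorm, Set.mem_ofPred_eq]
    split_ifs <;> simp
  have hcont : ContinuousOn (fun p : ℝ × ℝ => p.1 • g (c + p.1 * Complex.exp (p.2 * Complex.I)))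
      (Set.Icc 0 R ×ˢ Set.Icc (-Real.pi) Real.pi) := by
    refine continuousOn_fst.smul (hg.comp (Continuous.continuousOn (by fun_prop)) fun p hp => ?_)
    simp [Complex.norm_exp_ofReal_mul_I, abs_of_nonneg hp.1.1, hp.1.2]
  have hint := (hcont.integrableOn_compact (μ := volume) (isCompact_Icc.prod isCompact_Icc)).mono_set
    (Set.prod_mono Set.Ioo_subset_Icc_self Set.Ioo_subset_Icc_self)
  rw [h1, ← Complex.integral_comp_polarCoord_symm]
  change ∫ p in Complex.polarCoord.target, _ = _
  rw [h2, setIntegral_indicator hmeas, hset, Measure.volume_eq_prod, setIntegral_prod _ hint,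
    intervalIntegral.integral_of_le hR, integral_Ioc_eq_integral_Ioo]
  refine setIntegral_congr_fun measurableSet_Ioo fun ρ _ => ?_
  rw [intervalIntegral.integral_of_le (by linarith [Real.pi_pos]), integral_Ioc_eq_integral_Ioo]

/-- **Green's theorem** on a rectangle for the pull-back of the area form under a `C²` map. -/
theorem integral_integral_conj_fderiv_mul_fderiv_im {P : ℝ × ℝ → ℂ} {a₁ b₁ a₂ b₂ : ℝ}
    (hP : ∀ p ∈ Set.uIcc a₁ b₁ ×ˢ Set.uIcc a₂ b₂, ContDiffAt ℝ 2 P p) :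
    ∫ x in a₁..b₁, ∫ y in a₂..b₂,
        2 * (conj (fderiv ℝ P (x, y) (1, 0)) * fderiv ℝ P (x, y) (0, 1)).im =
      (((∫ x in a₁..b₁, -(conj (P (x, b₂)) * fderiv ℝ P (x, b₂) (1, 0)).im) -
        ∫ x in a₁..b₁, -(conj (P (x, a₂)) * fderiv ℝ P (x, a₂) (1, 0)).im) +
        ∫ y in a₂..b₂, (conj (P (b₁, y)) * fderiv ℝ P (b₁, y) (0, 1)).im) -
        ∫ y in a₂..b₂, (conj (P (a₁, y)) * fderiv ℝ P (a₁, y) (0, 1)).im := by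
  have hd : ∀ p ∈ Set.uIcc a₁ b₁ ×ˢ Set.uIcc a₂ b₂, DifferentiableAt ℝ P p := fun p hp =>
    (hP p hp).differentiableAt two_ne_zero
  have hd2 : ∀ p ∈ Set.uIcc a₁ b₁ ×ˢ Set.uIcc a₂ b₂, DifferentiableAt ℝ (fderiv ℝ P) p :=
    fun p hp => ((hP p hp).fderiv_right (m := 1) (by norm_num)).differentiableAt one_ne_zero
  have hprod : ∀ v : ℝ × ℝ, ∀ p ∈ Set.uIcc a₁ b₁ ×ˢ Set.uIcc a₂ b₂, ∃ D : ℝ × ℝ →L[ℝ] ℝ,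
      HasFDerivAt (fun p => (conj (P p) * fderiv ℝ P p v).im) D p ∧
      ∀ w, D w = (conj (fderiv ℝ P p w) * fderiv ℝ P p v +
        conj (P p) * fderiv ℝ (fderiv ℝ P) p w v).im := by
    intro v p hp
    have h1 := (hd p hp).hasFDerivAt
    have h2 : HasFDerivAt (fun q => fderiv ℝ P q v)
        ((ContinuousLinearMap.apply ℝ ℂ v).comp (fderiv ℝ (fderiv ℝ P) p)) p :=
      (ContinuousLinearMap.apply ℝ ℂ v).hasFDerivAt.comp p (hd2 p hp).hasFDerivAt
    have h3 := (Complex.conjCLE.toContinuousLinearMap.hasFDerivAt (x := P p)).comp p h1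
    have h4 := (Complex.imCLM.hasFDerivAt).comp p (h3.mul h2)
    refine ⟨_, h4, fun w => ?_⟩
    simp
    ring
  choose! D hD hDw using hprod
  -- The exterior derivative of the 1-form `Im (conj P dP)`: the second-order terms cancel by
  -- symmetry of the second derivative.
  have hsym : ∀ p ∈ Set.uIcc a₁ b₁ ×ˢ Set.uIcc a₂ b₂,
      D (0, 1) p (1, 0) + (-D (1, 0) p) (0, 1) =
        2 * (conj (fderiv ℝ P p (1, 0)) * fderiv ℝ P p (0, 1)).im := by
    intro p hp
    have := ((hP p hp).isSymmSndFDerivAt (by simp)).eq (1, 0) (0, 1)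
    rw [neg_apply, hDw _ p hp, hDw _ p hp, this]
    simp only [Complex.add_im, Complex.mul_im, Complex.conj_re, Complex.conj_im]
    ring
  have hcont : ∀ v, ContinuousOn (fun p => (conj (P p) * fderiv ℝ P p v).im)
      (Set.uIcc a₁ b₁ ×ˢ Set.uIcc a₂ b₂) := fun v p hp =>
    (hD v p hp).continuousAt.continuousWithinAt
  have hsub : ∀ p ∈ Set.Ioo (min a₁ b₁) (max a₁ b₁) ×ˢ Set.Ioo (min a₂ b₂) (max a₂ b₂),
      p ∈ Set.uIcc a₁ b₁ ×ˢ Set.uIcc a₂ b₂ := fun p hp =>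
    ⟨Set.Ioo_subset_Icc_self hp.1, Set.Ioo_subset_Icc_self hp.2⟩
  have hfc : ∀ v, ContinuousOn (fun p => fderiv ℝ P p v) (Set.uIcc a₁ b₁ ×ˢ Set.uIcc a₂ b₂) :=
    fun v p hp => ((hd2 p hp).continuousAt.clm_apply continuousAt_const).continuousWithinAt
  have hint : IntegrableOn (fun p => D (0, 1) p (1, 0) + (-D (1, 0) p) (0, 1))
      (Set.uIcc a₁ b₁ ×ˢ Set.uIcc a₂ b₂) := by
    refine IntegrableOn.congr_fun (ContinuousOn.integrableOn_compact
      (isCompact_uIcc.prod isCompact_uIcc) ?_) (fun p hp => (hsym p hp).symm)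
      (measurableSet_uIcc.prod measurableSet_uIcc)
    have h1 := hfc (1, 0)
    have h2 := hfc (0, 1)
    have h3 := Complex.continuous_conj.comp_continuousOn h1
    exact continuousOn_const.mul (Complex.continuous_im.comp_continuousOn (h3.mul h2))
  have key := integral2_divergence_prod_of_hasFDerivAt
    (fun p => (conj (P p) * fderiv ℝ P p (0, 1)).im)
    (fun p => -(conj (P p) * fderiv ℝ P p (1, 0)).im)
    (D (0, 1)) (fun p => -D (1, 0) p) a₁ a₂ b₁ b₂ (hcont _) (hcont _).neg
    (fun p hp => hD _ p (hsub p hp)) (fun p hp => (hD _ p (hsub p hp)).neg) hint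
  rw [← key]
  refine intervalIntegral.integral_congr fun x hx => ?_
  exact intervalIntegral.integral_congr fun y hy => (hsym (x, y) ⟨hx, hy⟩).symm

theorem fderiv_eq_dz_mul_add_dzbar_mul_conj (f : ℂ → ℂ) (z v : ℂ) :
    fderiv ℝ f z v = dz f z * v + dzbar f z * conj v := by
  have h : fderiv ℝ f z v = v.re * fderiv ℝ f z 1 + v.im * fderiv ℝ f z Complex.I := by
    conv_lhs => rw [show v = v.re • (1 : ℂ) + v.im • Complex.I by simp]
    rw [map_add, map_smul, map_smul, Complex.real_smul, Complex.real_smul]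
  have hv : conj v = v.re - v.im * Complex.I := by
    apply Complex.ext <;> simp
  rw [h, dz, dzbar, hv]
  conv_rhs => rw [← Complex.re_add_im v]
  simp only [Complex.add_re, Complex.add_im, Complex.ofReal_re, Complex.ofReal_im,
    Complex.re_ofReal_mul, Complex.im_ofReal_mul, Complex.I_re, Complex.I_im]
  push_cast
  linear_combination ((v.im : ℂ) * fderiv ℝ f z Complex.I) * Complex.I_sq

/-- The area of the image of a disk, counted with multiplicity, as a boundary integral. -/
theorem two_mul_setIntegral_jacobian {f : ℂ → ℂ} {r : ℝ} (hr : 0 ≤ r)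
    (hf : ∀ z ∈ Metric.closedBall (0 : ℂ) r, ContDiffAt ℝ 2 f z) :
    2 * ∫ z in Metric.ball (0 : ℂ) r, jacobian f z =
      ∫ θ in (-Real.pi)..Real.pi, (conj (f (r * Complex.exp (θ * Complex.I))) *
        fderiv ℝ f (r * Complex.exp (θ * Complex.I))
          (Complex.I * (r * Complex.exp (θ * Complex.I)))).im := by
  set pol : ℝ × ℝ → ℂ := fun p => p.1 * Complex.exp (p.2 * Complex.I) with hpol
  have hpolc : ContDiff ℝ 2 pol := by
    have : ContDiff ℝ 2 (fun x : ℝ => (x : ℂ)) := Complex.ofRealCLM.contDiff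
    exact (this.comp contDiff_fst).mul
      (((this.comp contDiff_snd).mul contDiff_const).cexp)
  have hmem : ∀ p ∈ Set.uIcc 0 r ×ˢ Set.uIcc (-Real.pi) Real.pi,
      pol p ∈ Metric.closedBall (0 : ℂ) r := by
    intro p hp
    have := hp.1
    rw [Set.uIcc_of_le hr] at this
    simp [hpol, Complex.norm_exp_ofReal_mul_I, abs_of_nonneg this.1, this.2]
  have hdpol : ∀ p, DifferentiableAt ℝ pol p := fun p =>
    (hpolc.differentiable two_ne_zero) p
  have hpol1 : ∀ p : ℝ × ℝ, fderiv ℝ pol p (1, 0) = Complex.exp (p.2 * Complex.I) := by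
    intro p
    have h1 : HasDerivAt (fun x : ℝ => (x, p.2)) (1, 0) p.1 :=
      (hasDerivAt_id p.1).prodMk (hasDerivAt_const _ _)
    have h2 := (hdpol p).hasFDerivAt.comp_hasDerivAt_of_eq p.1 h1 rfl
    have h3 : HasDerivAt (pol ∘ fun x : ℝ => (x, p.2)) (1 * Complex.exp (p.2 * Complex.I)) p.1 :=
      (Complex.ofRealCLM.hasDerivAt (x := p.1)).mul_const (Complex.exp (p.2 * Complex.I))
    rw [h2.unique h3, one_mul]
  have hpol2 : ∀ p : ℝ × ℝ, fderiv ℝ pol p (0, 1) = Complex.I * pol p := by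
    intro p
    have h1 : HasDerivAt (fun y : ℝ => (p.1, y)) (0, 1) p.2 :=
      (hasDerivAt_const _ _).prodMk (hasDerivAt_id p.2)
    have h2 := (hdpol p).hasFDerivAt.comp_hasDerivAt_of_eq p.2 h1 rfl
    have h3 : HasDerivAt (pol ∘ fun y : ℝ => (p.1, y))
        (p.1 * (Complex.exp (p.2 * Complex.I) * (1 * Complex.I))) p.2 :=
      (((Complex.ofRealCLM.hasDerivAt (x := p.2)).mul_const Complex.I).cexp).const_mul (p.1 : ℂ)
    rw [h2.unique h3, hpol]
    ring
  have hP : ∀ p ∈ Set.uIcc 0 r ×ˢ Set.uIcc (-Real.pi) Real.pi, ContDiffAt ℝ 2 (f ∘ pol) p :=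
    fun p hp => (hf _ (hmem p hp)).comp p hpolc.contDiffAt
  have hfd : ∀ x ∈ Set.uIcc 0 r, ∀ y ∈ Set.uIcc (-Real.pi) Real.pi, ∀ v,
      fderiv ℝ (f ∘ pol) (x, y) v = fderiv ℝ f (pol (x, y)) (fderiv ℝ pol (x, y) v) := by
    intro x hx y hy v
    rw [fderiv_comp _ ((hf _ (hmem _ ⟨hx, hy⟩)).differentiableAt two_ne_zero) (hdpol _)]
    rfl
  have green := integral_integral_conj_fderiv_mul_fderiv_im hP
  have hperiod : ∀ x : ℝ, pol (x, Real.pi) = pol (x, -Real.pi) := by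
    intro x
    simp [hpol, Complex.exp_neg]
  have hpiL : -Real.pi ∈ Set.uIcc (-Real.pi) Real.pi := Set.left_mem_uIcc
  have hpiR : Real.pi ∈ Set.uIcc (-Real.pi) Real.pi := Set.right_mem_uIcc
  -- Of the four edges only `ρ = r` survives: the edges at angles `±π` have the same image and
  -- cancel, and the edge `ρ = 0` collapses to a point.
  have e1 : ∫ x in (0 : ℝ)..r, -(conj ((f ∘ pol) (x, Real.pi)) *
        fderiv ℝ (f ∘ pol) (x, Real.pi) (1, 0)).im =
      ∫ x in (0 : ℝ)..r, -(conj ((f ∘ pol) (x, -Real.pi)) *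
        fderiv ℝ (f ∘ pol) (x, -Real.pi) (1, 0)).im := by
    refine intervalIntegral.integral_congr fun x hx => ?_
    simp only [hfd _ hx _ hpiL, hfd _ hx _ hpiR, Function.comp_apply, hpol1, hperiod]
    simp [Complex.exp_neg]
  have e2 : ∫ y in (-Real.pi)..Real.pi, (conj ((f ∘ pol) (0, y)) *
        fderiv ℝ (f ∘ pol) (0, y) (0, 1)).im = 0 := by
    refine (intervalIntegral.integral_congr (g := fun _ => (0 : ℝ)) fun y hy => ?_).trans (by simp)
    have h0 := hfd 0 Set.left_mem_uIcc y hy (0, 1)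
    simp only [h0, hpol2]
    simp [hpol]
  rw [e1, sub_self, zero_add, e2, sub_zero] at green
  have hJc : ContinuousOn (jacobian f) (Metric.closedBall 0 r) := by
    have hfdc : ∀ v, ContinuousOn (fun z => fderiv ℝ f z v) (Metric.closedBall 0 r) :=
      fun v z hz => (((hf z hz).fderiv_right (m := 1) (by norm_num)).continuousAt.clm_apply
        continuousAt_const).continuousWithinAt
    have h1 := hfdc 1
    have h2 := hfdc Complex.I
    unfold jacobian dz dzbar
    fun_prop
  rw [setIntegral_ball_eq_polar hr hJc, ← intervalIntegral.integral_const_mul]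
  simp_rw [← intervalIntegral.integral_const_mul]
  calc _ = _ := ?_
    _ = _ := green
    _ = _ := ?_
  · refine intervalIntegral.integral_congr fun x hx => ?_
    refine intervalIntegral.integral_congr fun y hy => ?_
    simp only [hfd _ hx _ hy, hpol1, hpol2, fderiv_eq_dz_mul_add_dzbar_mul_conj, zero_add,
      smul_eq_mul, jacobian]
    simp only [hpol]
    set A := dz f (x * Complex.exp (y * Complex.I))
    set B := dzbar f (x * Complex.exp (y * Complex.I))
    have hE : Complex.normSq (Complex.exp (y * Complex.I)) = 1 := by
      rw [Complex.normSq_eq_norm_sq, Complex.norm_exp_ofReal_mul_I, one_pow]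
    generalize Complex.exp (y * Complex.I) = E at hE
    rw [Complex.normSq_apply] at hE
    rw [← Complex.normSq_eq_norm_sq, ← Complex.normSq_eq_norm_sq]
    simp only [Complex.normSq_apply, Complex.mul_im, Complex.mul_re, Complex.add_re,
      Complex.add_im, Complex.conj_re, Complex.conj_im, Complex.I_re, Complex.I_im,
      Complex.ofReal_re, Complex.ofReal_im]
    linear_combination (-2 * x * (A.re * A.re + A.im * A.im - (B.re * B.re + B.im * B.im))) * hE
  · refine intervalIntegral.integral_congr fun y hy => ?_
    simp only [hfd _ Set.right_mem_uIcc _ hy, hpol2, Function.comp_apply]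
    simp only [hpol]

/-! ### Periodicity on circles and the area mean value property. -/

theorem intervalIntegral_neg_pi_pi_eq {E : Type*} [NormedAddCommGroup E] [NormedSpace ℝ E]
    {g : ℝ → E} (hg : Function.Periodic g (2 * Real.pi)) :
    ∫ θ in (-Real.pi)..Real.pi, g θ = ∫ θ in (0 : ℝ)..(2 * Real.pi), g θ := by
  have h := hg.intervalIntegral_add_eq (-Real.pi) 0
  rwa [zero_add, show -Real.pi + 2 * Real.pi = Real.pi by ring] at h

theorem exp_ofReal_add_two_pi_mul_I (θ : ℝ) :
    Complex.exp (((θ + 2 * Real.pi : ℝ) : ℂ) * Complex.I) = Complex.exp (θ * Complex.I) := by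
  have : ((θ + 2 * Real.pi : ℝ) : ℂ) * Complex.I = θ * Complex.I + 2 * Real.pi * Complex.I := by
    push_cast; ring
  rw [this, Complex.exp_periodic]

/-- The area mean value property of holomorphic functions. -/
theorem setIntegral_ball_eq_of_differentiableOn {p : ℂ → ℂ} {U : Set ℂ} (hU : IsOpen U)
    (hp : DifferentiableOn ℂ p U) {c : ℂ} {s : ℝ} (hs : 0 ≤ s) (hsub : Metric.closedBall c s ⊆ U) :
    ∫ z in Metric.ball c s, p z = (Real.pi * s ^ 2 : ℝ) • p c := by
  rw [setIntegral_ball_eq_polar hs (hp.continuousOn.mono hsub)]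
  have hmean : ∀ ρ ∈ Set.uIcc 0 s, ∫ θ in (-Real.pi)..Real.pi,
      ρ • p (c + ρ * Complex.exp (θ * Complex.I)) = ρ • ((2 * Real.pi) • p c) := by
    intro ρ hρ
    rw [Set.uIcc_of_le hs] at hρ
    have hsub' : Metric.closedBall c |ρ| ⊆ U :=
      (Metric.closedBall_subset_closedBall (by rw [abs_of_nonneg hρ.1]; exact hρ.2)).trans hsub
    have h := circleAverage_of_differentiable_on_off_countable (f := p) (c := c) (R := ρ)
      Set.countable_empty (hp.continuousOn.mono hsub')
      (fun z hz => hp.differentiableAt (hU.mem_nhds (hsub' (Metric.ball_subset_closedBall hz.1))))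
    rw [intervalIntegral.integral_smul, ← h, Real.circleAverage,
      smul_inv_smul₀ Real.two_pi_pos.ne', intervalIntegral_neg_pi_pi_eq]
    · rfl
    · intro θ
      simp only [exp_ofReal_add_two_pi_mul_I]
  rw [intervalIntegral.integral_congr hmean, intervalIntegral.integral_smul_const, integral_id,
    smul_smul]
  congr 1
  ring

/-! ### Holomorphy of the Wirtinger derivatives of a harmonic mapping. -/

theorem isOpen_unitDisk : IsOpen unitDisk := Metric.isOpen_ball

theorem mem_unitDisk {z : ℂ} : z ∈ unitDisk ↔ ‖z‖ < 1 := by simp [unitDisk]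

theorem norm_ofReal_mul_exp {r : ℝ} (hr : 0 ≤ r) (θ : ℝ) :
    ‖(r : ℂ) * Complex.exp (θ * Complex.I)‖ = r := by
  simp [Complex.norm_exp_ofReal_mul_I, abs_of_nonneg hr]

namespace IsHarmonicMapping

variable {f : ℂ → ℂ} {z : ℂ}

theorem contDiffAt (hf : IsHarmonicMapping f) (hz : z ∈ unitDisk) : ContDiffAt ℝ 2 f z := by
  have h1 : ContDiffAt ℝ 2 (fun w => ((f w).re : ℂ)) z :=
    Complex.ofRealCLM.contDiff.contDiffAt.comp z (hf.1 z hz).1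
  have h2 : ContDiffAt ℝ 2 (fun w => ((f w).im : ℂ)) z :=
    Complex.ofRealCLM.contDiff.contDiffAt.comp z (hf.2 z hz).1
  have h3 := h1.add (h2.mul (contDiffAt_const (c := Complex.I)))
  exact h3.congr_of_eventuallyEq (Filter.Eventually.of_forall fun w => (Complex.re_add_im _).symm)

theorem fderiv_eq (hf : IsHarmonicMapping f) (hz : z ∈ unitDisk) (v : ℂ) :
    fderiv ℝ f z v =
      fderiv ℝ (fun w => (f w).re) z v + fderiv ℝ (fun w => (f w).im) z v * Complex.I := by
  have hd := ((hf.contDiffAt hz).differentiableAt two_ne_zero).hasFDerivAt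
  have h1 := (Complex.reCLM.hasFDerivAt.comp z hd).fderiv
  have h2 := (Complex.imCLM.hasFDerivAt.comp z hd).fderiv
  have e1 : (Complex.reCLM ∘ f) = fun w => (f w).re := rfl
  have e2 : (Complex.imCLM ∘ f) = fun w => (f w).im := rfl
  rw [e1] at h1
  rw [e2] at h2
  rw [h1, h2]
  simp [Complex.re_add_im]

/-- For a real harmonic `u`, Laplace's equation is a Cauchy–Riemann equation for `u_x - i u_y`. With
`f = u + i v`, the derivative `f_z` is half of `(u_x - i u_y) + i (v_x - i v_y)`. -/
theorem differentiableOn_dz (hf : IsHarmonicMapping f) :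
    DifferentiableOn ℂ (dz f) unitDisk := by
  have h : DifferentiableOn ℂ (fun z =>
      ((fderiv ℝ (fun w => (f w).re) z 1 - Complex.I * fderiv ℝ (fun w => (f w).re) z Complex.I) +
      Complex.I * (fderiv ℝ (fun w => (f w).im) z 1 -
        Complex.I * fderiv ℝ (fun w => (f w).im) z Complex.I)) / 2) unitDisk := by
    intro z hz
    have h1 := HarmonicAt.differentiableAt_complex_partial (hf.1 z hz)
    have h2 := HarmonicAt.differentiableAt_complex_partial (hf.2 z hz)
    exact ((h1.add (h2.const_mul _)).div_const _).differentiableWithinAt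
  refine h.congr fun z hz => ?_
  rw [dz, hf.fderiv_eq hz, hf.fderiv_eq hz]
  ring

/-- The same computation with the sign of `v` reversed: conjugating `f_{z̄}` gives the
`z`-derivative of `u - i v`. -/
theorem differentiableOn_conj_dzbar (hf : IsHarmonicMapping f) :
    DifferentiableOn ℂ (fun z => conj (dzbar f z)) unitDisk := by
  have h : DifferentiableOn ℂ (fun z =>
      ((fderiv ℝ (fun w => (f w).re) z 1 - Complex.I * fderiv ℝ (fun w => (f w).re) z Complex.I) -
      Complex.I * (fderiv ℝ (fun w => (f w).im) z 1 -
        Complex.I * fderiv ℝ (fun w => (f w).im) z Complex.I)) / 2) unitDisk := by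
    intro z hz
    have h1 := HarmonicAt.differentiableAt_complex_partial (hf.1 z hz)
    have h2 := HarmonicAt.differentiableAt_complex_partial (hf.2 z hz)
    exact ((h1.sub (h2.const_mul _)).div_const _).differentiableWithinAt
  refine h.congr fun z hz => ?_
  rw [dzbar, hf.fderiv_eq hz, hf.fderiv_eq hz]
  simp only [map_div₀, map_add, map_mul, Complex.conj_ofReal, Complex.conj_I, map_ofNat]
  ring

theorem continuousOn_dz (hf : IsHarmonicMapping f) : ContinuousOn (dz f) unitDisk :=
  hf.differentiableOn_dz.continuousOn

theorem continuousOn_dzbar (hf : IsHarmonicMapping f) : ContinuousOn (dzbar f) unitDisk := by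
  refine (Complex.continuous_conj.comp_continuousOn
    hf.differentiableOn_conj_dzbar.continuousOn).congr fun z _ => ?_
  simp

end IsHarmonicMapping

/-! ### Lengths of image circles and areas of image disks. -/

/-- This is the velocity of `θ ↦ f (r e^{iθ})`; its modulus is the integrand of `circleLength`,
which ties that definition to an actual arc length. -/
theorem fderiv_tangent_eq (f : ℂ → ℂ) (r θ : ℝ) :
    fderiv ℝ f (r * Complex.exp (θ * Complex.I)) (Complex.I * (r * Complex.exp (θ * Complex.I))) =
      Complex.I * (r * Complex.exp (θ * Complex.I)) *
        (dz f (r * Complex.exp (θ * Complex.I)) -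
          Complex.exp (-2 * θ * Complex.I) * dzbar f (r * Complex.exp (θ * Complex.I))) := by
  rw [fderiv_eq_dz_mul_add_dzbar_mul_conj]
  have h1 : conj (Complex.exp (θ * Complex.I)) =
      Complex.exp (θ * Complex.I) * Complex.exp (-2 * θ * Complex.I) := by
    rw [← Complex.exp_conj, ← Complex.exp_add]
    congr 1
    simp only [map_mul, Complex.conj_ofReal, Complex.conj_I]
    ring
  simp only [map_mul, Complex.conj_ofReal, Complex.conj_I, h1]
  ring

theorem norm_fderiv_tangent_eq (f : ℂ → ℂ) {r : ℝ} (hr : 0 ≤ r) (θ : ℝ) :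
    ‖fderiv ℝ f (r * Complex.exp (θ * Complex.I))
        (Complex.I * (r * Complex.exp (θ * Complex.I)))‖ =
      r * ‖dz f (r * Complex.exp (θ * Complex.I)) -
          Complex.exp (-2 * θ * Complex.I) * dzbar f (r * Complex.exp (θ * Complex.I))‖ := by
  rw [fderiv_tangent_eq, norm_mul, norm_mul, norm_ofReal_mul_exp hr, Complex.norm_I, one_mul]

theorem norm_exp_neg_two_mul (θ : ℝ) : ‖Complex.exp (-2 * θ * Complex.I)‖ = 1 := by
  have := Complex.norm_exp_ofReal_mul_I (-2 * θ)
  push_cast at this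
  exact this

theorem norm_dz_sub_norm_dzbar_le (f : ℂ → ℂ) (z : ℂ) (θ : ℝ) :
    ‖dz f z‖ - ‖dzbar f z‖ ≤ ‖dz f z - Complex.exp (-2 * θ * Complex.I) * dzbar f z‖ := by
  have := norm_sub_norm_le (dz f z) (Complex.exp (-2 * θ * Complex.I) * dzbar f z)
  rwa [norm_mul, norm_exp_neg_two_mul, one_mul] at this

theorem IsSensePreserving.norm_dzbar_lt {f : ℂ → ℂ} (hf : IsSensePreserving f) {z : ℂ}
    (hz : z ∈ unitDisk) : ‖dzbar f z‖ < ‖dz f z‖ := by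
  have h := hf z hz
  unfold jacobian at h
  nlinarith [norm_nonneg (dz f z), norm_nonneg (dzbar f z)]

theorem circleLength_eq (f : ℂ → ℂ) {r : ℝ} (hr : 0 ≤ r) :
    circleLength f r = ∫ θ in (0 : ℝ)..(2 * Real.pi), ‖fderiv ℝ f (r * Complex.exp (θ * Complex.I))
        (Complex.I * (r * Complex.exp (θ * Complex.I)))‖ := by
  simp_rw [norm_fderiv_tangent_eq f hr, intervalIntegral.integral_const_mul]
  rfl

/-- The isoperimetric inequality for the images of disks under harmonic mappings. -/
theorem setIntegral_jacobian_le {f : ℂ → ℂ} (hf : IsHarmonicMapping f) (hs : IsSensePreserving f)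
    {r : ℝ} (hr0 : 0 < r) (hr1 : r < 1) :
    ∫ z in Metric.ball (0 : ℂ) r, jacobian f z ≤ circleLength f r ^ 2 / (4 * Real.pi) := by
  have hmem : ∀ θ : ℝ, (r : ℂ) * Complex.exp (θ * Complex.I) ∈ unitDisk := fun θ => by
    rw [mem_unitDisk, norm_ofReal_mul_exp hr0.le]; exact hr1
  have hF : ∀ θ : ℝ, HasDerivAt (fun θ : ℝ => f (r * Complex.exp (θ * Complex.I)))
      (fderiv ℝ f (r * Complex.exp (θ * Complex.I))
        (Complex.I * (r * Complex.exp (θ * Complex.I)))) θ := by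
    intro θ
    have h1 : HasDerivAt (fun θ : ℝ => (r : ℂ) * Complex.exp (θ * Complex.I))
        (r * (Complex.exp (θ * Complex.I) * (1 * Complex.I))) θ :=
      (((Complex.ofRealCLM.hasDerivAt (x := θ)).mul_const Complex.I).cexp).const_mul (r : ℂ)
    have h2 := ((hf.contDiffAt (hmem θ)).differentiableAt two_ne_zero).hasFDerivAt.comp_hasDerivAt
      θ h1
    rw [show Complex.I * (r * Complex.exp (θ * Complex.I)) =
      r * (Complex.exp (θ * Complex.I) * (1 * Complex.I)) by ring]
    exact h2
  have hcirc : Continuous (fun θ : ℝ => (r : ℂ) * Complex.exp (θ * Complex.I)) := by fun_prop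
  have hF' : Continuous (fun θ : ℝ => fderiv ℝ f (r * Complex.exp (θ * Complex.I))
        (Complex.I * (r * Complex.exp (θ * Complex.I)))) := by
    simp_rw [fderiv_eq_dz_mul_add_dzbar_mul_conj]
    have h1 := hf.continuousOn_dz.comp_continuous hcirc hmem
    have h2 := hf.continuousOn_dzbar.comp_continuous hcirc hmem
    fun_prop
  -- A positive Jacobian gives `|f_z| > |f_{z̄}|`, so the image curve is regular and can be
  -- parametrised by arc length.
  have hne : ∀ θ : ℝ, fderiv ℝ f (r * Complex.exp (θ * Complex.I))
        (Complex.I * (r * Complex.exp (θ * Complex.I))) ≠ 0 := by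
    intro θ
    rw [← norm_pos_iff, norm_fderiv_tangent_eq f hr0.le]
    have h1 := hs.norm_dzbar_lt (hmem θ)
    have h2 := norm_dz_sub_norm_dzbar_le f (r * Complex.exp (θ * Complex.I)) θ
    exact mul_pos hr0 (by linarith)
  have iso := integral_conj_mul_deriv_im_le Real.two_pi_pos hF hF' hne
    (fun θ => by simp only [exp_ofReal_add_two_pi_mul_I])
    (by simp)
  have area := two_mul_setIntegral_jacobian hr0.le (f := f) (fun z hz => hf.contDiffAt
    (mem_unitDisk.2 ((mem_closedBall_zero_iff.1 hz).trans_lt hr1)))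
  rw [intervalIntegral_neg_pi_pi_eq (fun θ => by simp only [exp_ofReal_add_two_pi_mul_I])] at area
  rw [← area, ← circleLength_eq f hr0.le] at iso
  rw [show circleLength f r ^ 2 / (4 * Real.pi) = circleLength f r ^ 2 / (2 * Real.pi) / 2 by
    field_simp; norm_num]
  linarith

theorem circleLength_le_toReal_boundaryLength {f : ℂ → ℂ} (hb : boundaryLength f < ⊤) {r : ℝ}
    (hr0 : 0 < r) (hr1 : r < 1) : circleLength f r ≤ (boundaryLength f).toReal := by
  rw [← ENNReal.ofReal_le_iff_le_toReal hb.ne]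
  exact le_iSup₂ (f := fun r (_ : r ∈ Set.Ioo (0 : ℝ) 1) => ENNReal.ofReal (circleLength f r)) r
    ⟨hr0, hr1⟩

theorem circleLength_nonneg (f : ℂ → ℂ) {r : ℝ} (hr : 0 ≤ r) : 0 ≤ circleLength f r :=
  mul_nonneg hr (intervalIntegral.integral_nonneg Real.two_pi_pos.le fun _ _ => norm_nonneg _)

/-! ### The bound on `Λ_f`. -/

/-- Rotating `y` to the argument of `x` turns a sum of moduli into the modulus of one number. It is
applied to the two Wirtinger derivatives at a point, and to a pair of coefficients. -/
theorem exists_norm_eq_one_norm_add_mul (x y : ℂ) : ∃ c : ℂ, ‖c‖ = 1 ∧ ‖x + c * y‖ = ‖x‖ + ‖y‖ := by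
  refine ⟨Complex.exp ((x.arg - y.arg : ℝ) * Complex.I), Complex.norm_exp_ofReal_mul_I _, ?_⟩
  have hy : Complex.exp ((x.arg - y.arg : ℝ) * Complex.I) * y =
      ‖y‖ * Complex.exp (x.arg * Complex.I) := by
    have h := Complex.norm_mul_exp_arg_mul_I y
    have hadd : Complex.exp ((x.arg - y.arg : ℝ) * Complex.I) * Complex.exp (y.arg * Complex.I) =
        Complex.exp (x.arg * Complex.I) := by
      rw [← Complex.exp_add]
      congr 1
      push_cast
      ring
    rw [← hadd]
    linear_combination (-Complex.exp ((x.arg - y.arg : ℝ) * Complex.I)) * h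
  have hsum : x + Complex.exp ((x.arg - y.arg : ℝ) * Complex.I) * y =
      ((‖x‖ + ‖y‖ : ℝ) : ℂ) * Complex.exp (x.arg * Complex.I) := by
    rw [hy]
    push_cast
    linear_combination -Complex.norm_mul_exp_arg_mul_I x
  rw [hsum, norm_mul, Complex.norm_exp_ofReal_mul_I, mul_one,
    Complex.norm_of_nonneg (by positivity)]

/-- Multiply `Λ_f ≤ K λ_f` by `Λ_f` and use `λ_f Λ_f = J_f`, valid because `f` preserves
orientation. -/
theorem IsQuasiconformalHarmonic.bigLambda_sq_le {K : ℝ} {f : ℂ → ℂ}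
    (hf : IsQuasiconformalHarmonic K f) {z : ℂ} (hz : z ∈ unitDisk) :
    bigLambda f z ^ 2 ≤ K * jacobian f z := by
  have h1 := hf.quasiregular z hz
  have h2 := hf.sensePreserving.norm_dzbar_lt hz
  rw [smallLambda, abs_of_pos (sub_pos.2 h2)] at h1
  have h3 : 0 ≤ bigLambda f z := by unfold bigLambda; positivity
  calc bigLambda f z ^ 2 = bigLambda f z * bigLambda f z := sq _
    _ ≤ (K * (‖dz f z‖ - ‖dzbar f z‖)) * bigLambda f z := by gcongr
    _ = K * jacobian f z := by unfold bigLambda jacobian; ring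

theorem IsQuasiconformalHarmonic.bigLambda_mul_le {K : ℝ} {f : ℂ → ℂ}
    (hf : IsQuasiconformalHarmonic K f) (hb : boundaryLength f < ⊤) {z : ℂ} {s : ℝ} (hs0 : 0 < s)
    (hs1 : ‖z‖ + s < 1) :
    bigLambda f z * (2 * Real.pi * s) ≤ (boundaryLength f).toReal * Real.sqrt K := by
  have hK : 0 < K := one_pos.trans_le hf.one_le
  have hpi := Real.pi_pos
  set l := (boundaryLength f).toReal with hl
  have hl0 : 0 ≤ l := ENNReal.toReal_nonneg
  have hsub : Metric.closedBall z s ⊆ unitDisk := by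
    intro w hw
    rw [Metric.mem_closedBall, dist_eq_norm] at hw
    rw [mem_unitDisk]
    have := norm_le_norm_add_norm_sub' w z
    linarith
  have hsub2 : Metric.ball z s ⊆ Metric.ball 0 (‖z‖ + s) := by
    intro w hw
    rw [Metric.mem_ball, dist_eq_norm] at hw
    rw [mem_ball_zero_iff]
    have := norm_le_norm_add_norm_sub' w z
    linarith
  have hdisk : Metric.closedBall (0 : ℂ) (‖z‖ + s) ⊆ unitDisk := fun w hw =>
    mem_unitDisk.2 ((mem_closedBall_zero_iff.1 hw).trans_lt hs1)
  have hr0 : 0 < ‖z‖ + s := by positivity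
  obtain ⟨c, hc1, hc2⟩ := exists_norm_eq_one_norm_add_mul (dz f z) (conj (dzbar f z))
  -- The square makes `|p|` comparable with the Jacobian, hence with area; `c` gives `|p(z)| =
  -- Λ_f(z)²` at the centre.
  set p : ℂ → ℂ := fun w => (dz f w + c * conj (dzbar f w)) ^ 2 with hp
  have hpd : DifferentiableOn ℂ p unitDisk :=
    (hf.harmonic.differentiableOn_dz.add (hf.harmonic.differentiableOn_conj_dzbar.const_mul c)).pow 2
  have hpn : ∀ w ∈ unitDisk, ‖p w‖ ≤ K * jacobian f w := by
    intro w hw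
    refine le_trans ?_ (hf.bigLambda_sq_le hw)
    rw [hp, norm_pow]
    gcongr
    refine (norm_add_le _ _).trans_eq ?_
    rw [norm_mul, hc1, one_mul, RCLike.norm_conj, bigLambda]
  have hpz : ‖p z‖ = bigLambda f z ^ 2 := by
    rw [hp, norm_pow, hc2, RCLike.norm_conj, bigLambda]
  have hJc : ContinuousOn (jacobian f) unitDisk := by
    have h1 := hf.harmonic.continuousOn_dz
    have h2 := hf.harmonic.continuousOn_dzbar
    unfold jacobian
    fun_prop
  have hJi : IntegrableOn (jacobian f) (Metric.ball 0 (‖z‖ + s)) :=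
    ((hJc.mono hdisk).integrableOn_compact (isCompact_closedBall _ _)).mono_set
      Metric.ball_subset_closedBall
  have hKJi : IntegrableOn (fun w => K * jacobian f w) (Metric.ball 0 (‖z‖ + s)) := hJi.const_mul K
  have hmean := setIntegral_ball_eq_of_differentiableOn isOpen_unitDisk hpd hs0.le hsub
  have hlen := circleLength_le_toReal_boundaryLength hb hr0 hs1
  have key : bigLambda f z ^ 2 * (Real.pi * s ^ 2) ≤ K * (l ^ 2 / (4 * Real.pi)) := by
    calc bigLambda f z ^ 2 * (Real.pi * s ^ 2) = ‖∫ w in Metric.ball z s, p w‖ := by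
          rw [hmean, norm_smul, hpz, Real.norm_of_nonneg (by positivity), mul_comm]
      _ ≤ ∫ w in Metric.ball z s, K * jacobian f w :=
          norm_integral_le_of_norm_le (hKJi.mono_set hsub2) ((ae_restrict_mem measurableSet_ball).mono
            fun w hw => hpn w (hsub (Metric.ball_subset_closedBall hw)))
      _ ≤ ∫ w in Metric.ball 0 (‖z‖ + s), K * jacobian f w := by
          refine setIntegral_mono_set hKJi ((ae_restrict_mem measurableSet_ball).mono
            fun w hw => ?_) (Filter.Eventually.of_forall hsub2)
          exact mul_nonneg hK.le (hf.sensePreserving w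
            (hdisk (Metric.ball_subset_closedBall hw))).le
      _ = K * ∫ w in Metric.ball 0 (‖z‖ + s), jacobian f w := integral_const_mul _ _
      _ ≤ K * (circleLength f (‖z‖ + s) ^ 2 / (4 * Real.pi)) := by
          gcongr
          exact setIntegral_jacobian_le hf.harmonic hf.sensePreserving hr0 hs1
      _ ≤ K * (l ^ 2 / (4 * Real.pi)) := by
          have := circleLength_nonneg f hr0.le
          gcongr
  refine le_of_sq_le_sq ?_ (by positivity)
  rw [mul_pow l, Real.sq_sqrt hK.le]
  have : (bigLambda f z * (2 * Real.pi * s)) ^ 2 =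
      4 * Real.pi * (bigLambda f z ^ 2 * (Real.pi * s ^ 2)) := by ring
  rw [this]
  calc _ ≤ 4 * Real.pi * (K * (l ^ 2 / (4 * Real.pi))) := by gcongr
    _ = l ^ 2 * K := by field_simp

theorem IsQuasiconformalHarmonic.bigLambda_le {K : ℝ} {f : ℂ → ℂ}
    (hf : IsQuasiconformalHarmonic K f) (hb : boundaryLength f < ⊤) {z : ℂ} (hz : z ∈ unitDisk) :
    bigLambda f z ≤
      (boundaryLength f).toReal * Real.sqrt K / (2 * Real.pi * (1 - ‖z‖)) := by
  have hz1 : 0 < 1 - ‖z‖ := sub_pos.2 (mem_unitDisk.1 hz)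
  have hpi := Real.pi_pos
  rw [le_div_iff₀ (by positivity)]
  have hlim : Filter.Tendsto (fun s : ℝ => bigLambda f z * (2 * Real.pi * s))
      (nhdsWithin (1 - ‖z‖) (Set.Iio (1 - ‖z‖))) (nhds (bigLambda f z * (2 * Real.pi * (1 - ‖z‖)))) :=
    (Continuous.tendsto (by fun_prop) _).mono_left nhdsWithin_le_nhds
  refine le_of_tendsto hlim ?_
  filter_upwards [Ioo_mem_nhdsLT hz1] with s hs
  exact hf.bigLambda_mul_le hb hs.1 (by linarith [hs.2])

/-! ### Disk automorphisms and Lipschitz bounds in the hyperbolic distance. -/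

theorem norm_fderiv_le_bigLambda_mul (f : ℂ → ℂ) (z v : ℂ) :
    ‖fderiv ℝ f z v‖ ≤ bigLambda f z * ‖v‖ := by
  rw [fderiv_eq_dz_mul_add_dzbar_mul_conj]
  refine (norm_add_le _ _).trans_eq ?_
  rw [norm_mul, norm_mul, RCLike.norm_conj, bigLambda]
  ring

theorem one_add_conj_mul_ne_zero {z m : ℂ} (hz : ‖z‖ < 1) (hm : ‖m‖ < 1) : 1 + conj z * m ≠ 0 := by
  intro h
  have h1 : ‖conj z * m‖ = 1 := by rw [eq_neg_of_add_eq_zero_right h, norm_neg, norm_one]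
  rw [norm_mul, RCLike.norm_conj] at h1
  nlinarith [norm_nonneg z, norm_nonneg m]

theorem norm_sq_one_add_conj_mul_sub (z m : ℂ) :
    ‖1 + conj z * m‖ ^ 2 - ‖z + m‖ ^ 2 = (1 - ‖z‖ ^ 2) * (1 - ‖m‖ ^ 2) := by
  simp only [← Complex.normSq_eq_norm_sq, Complex.normSq_apply, Complex.add_re, Complex.add_im,
    Complex.mul_re, Complex.mul_im, Complex.conj_re, Complex.conj_im, Complex.one_re,
    Complex.one_im]
  ring

/-- The Schwarz–Pick identity for a disk automorphism. -/
theorem one_sub_norm_sq_moebius {z m : ℂ} (hz : ‖z‖ < 1) (hm : ‖m‖ < 1) :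
    1 - ‖(z + m) / (1 + conj z * m)‖ ^ 2 =
      (1 - ‖z‖ ^ 2) * (1 - ‖m‖ ^ 2) / ‖1 + conj z * m‖ ^ 2 := by
  have h0 : ‖1 + conj z * m‖ ≠ 0 := norm_ne_zero_iff.2 (one_add_conj_mul_ne_zero hz hm)
  rw [← norm_sq_one_add_conj_mul_sub, norm_div, div_pow, sub_div, div_self (pow_ne_zero 2 h0)]

theorem norm_moebius_lt_one {z m : ℂ} (hz : ‖z‖ < 1) (hm : ‖m‖ < 1) :
    ‖(z + m) / (1 + conj z * m)‖ < 1 := by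
  have h := one_sub_norm_sq_moebius hz hm
  have h0 : 0 < ‖1 + conj z * m‖ := norm_pos_iff.2 (one_add_conj_mul_ne_zero hz hm)
  have h1 : 0 < 1 - ‖z‖ ^ 2 := by nlinarith [norm_nonneg z]
  have h2 : 0 < 1 - ‖m‖ ^ 2 := by nlinarith [norm_nonneg m]
  have h3 : 0 < (1 - ‖z‖ ^ 2) * (1 - ‖m‖ ^ 2) / ‖1 + conj z * m‖ ^ 2 := by positivity
  nlinarith [norm_nonneg ((z + m) / (1 + conj z * m))]

theorem hypDist_nonneg {z w : ℂ} (hz : z ∈ unitDisk) (hw : w ∈ unitDisk) : 0 ≤ hypDist z w := by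
  rw [mem_unitDisk] at hz hw
  have h := norm_moebius_lt_one (z := -z) (m := w) (by simpa using hz) hw
  rw [map_neg, neg_mul, ← sub_eq_add_neg, ← norm_neg, ← neg_div, neg_add, neg_neg,
    ← sub_eq_add_neg] at h
  have h0 := norm_nonneg ((z - w) / (1 - conj z * w))
  refine mul_nonneg (by norm_num) (Real.log_nonneg ?_)
  rw [one_le_div (by linarith)]
  linarith

/-- A map whose derivative is bounded by `C / (1 - |z|)` is Lipschitz for the hyperbolic
distance. -/
theorem norm_sub_le_mul_hypDist {f : ℂ → ℂ} {C : ℝ}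
    (hf : ∀ z ∈ unitDisk, DifferentiableAt ℝ f z)
    (hC : ∀ z ∈ unitDisk, bigLambda f z ≤ C / (1 - ‖z‖)) {z w : ℂ}
    (hz : z ∈ unitDisk) (hw : w ∈ unitDisk) : ‖f z - f w‖ ≤ 2 * C * hypDist z w := by
  rw [mem_unitDisk] at hz hw
  have hC0 : 0 ≤ C := by
    have h := hC 0 (by simp [mem_unitDisk])
    have : 0 ≤ bigLambda f 0 := by unfold bigLambda; positivity
    simpa using this.trans h
  set m : ℂ := (w - z) / (1 - conj z * w) with hm
  set T : ℝ := ‖m‖ with hT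
  have hTeq : ‖(z - w) / (1 - conj z * w)‖ = T := by
    rw [hT, hm, ← norm_neg, ← neg_div, neg_sub]
  have hT1 : T < 1 := by
    have h := norm_moebius_lt_one (z := -z) (m := w) (by simpa using hz) hw
    rwa [map_neg, neg_mul, ← sub_eq_add_neg, neg_add_eq_sub] at h
  have hT0 : 0 ≤ T := norm_nonneg m
  set u : ℂ := Complex.exp (m.arg * Complex.I) with hu
  have hu1 : ‖u‖ = 1 := Complex.norm_exp_ofReal_mul_I _
  have hum : (T : ℂ) * u = m := Complex.norm_mul_exp_arg_mul_I m
  have htu : ∀ t ∈ Set.Icc 0 T, ‖(t : ℂ) * u‖ = t := fun t ht => by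
    rw [norm_mul, hu1, mul_one, Complex.norm_of_nonneg ht.1]
  have htu1 : ∀ t ∈ Set.Icc 0 T, ‖(t : ℂ) * u‖ < 1 := fun t ht => by
    rw [htu t ht]; exact ht.2.trans_lt hT1
  -- The hyperbolic geodesic from `z` to `w`: the image of the segment from `0` to `m` under the
  -- automorphism taking `0` to `z` and `m` to `w`.
  set φ : ℝ → ℂ := fun t => (z + t * u) / (1 + conj z * (t * u)) with hφ
  set φ' : ℝ → ℂ := fun t => u * (1 - ‖z‖ ^ 2 : ℝ) / (1 + conj z * (t * u)) ^ 2 with hφ'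
  have hφd : ∀ t ∈ Set.Icc 0 T, HasDerivAt φ (φ' t) t := by
    intro t ht
    have hne := one_add_conj_mul_ne_zero hz (htu1 t ht)
    have h0 : HasDerivAt (fun t : ℝ => (t : ℂ) * u) u t := by
      simpa using (Complex.ofRealCLM.hasDerivAt (x := t)).mul_const u
    have h1 := (h0.const_add z).div ((h0.const_mul (conj z)).const_add 1) hne
    refine h1.congr_deriv ?_
    rw [hφ']
    congr 1
    have : ((‖z‖ ^ 2 : ℝ) : ℂ) = z * conj z := by
      rw [Complex.mul_conj, Complex.normSq_eq_norm_sq]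
    push_cast at this ⊢
    rw [this]
    ring
  have hφmem : ∀ t ∈ Set.Icc 0 T, φ t ∈ unitDisk := fun t ht =>
    mem_unitDisk.2 (norm_moebius_lt_one hz (htu1 t ht))
  have hFd : ∀ t ∈ Set.Icc 0 T,
      HasDerivAt (fun t => f (φ t) - f z) (fderiv ℝ f (φ t) (φ' t)) t := fun t ht =>
    ((hf _ (hφmem t ht)).hasFDerivAt.comp_hasDerivAt t (hφd t ht)).sub_const _
  -- The majorant is `2C arctanh t`, which at `t = T` equals `2C` times the hyperbolic distance.
  have hBd : ∀ t ∈ Set.Icc 0 T,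
      HasDerivAt (fun t : ℝ => C * (Real.log (1 + t) - Real.log (1 - t)))
        (2 * C / (1 - t ^ 2)) t := by
    intro t ht
    have h1 : 0 < 1 + t := by linarith [ht.1]
    have h2 : 0 < 1 - t := by linarith [ht.2]
    have h := ((((hasDerivAt_id t).const_add 1).log h1.ne').sub
      (((hasDerivAt_id t).const_sub 1).log h2.ne')).const_mul C
    refine h.congr_deriv ?_
    simp only [id]
    have h3 : 1 - t ^ 2 = (1 + t) * (1 - t) := by ring
    rw [h3]
    field_simp
    ring
  -- Schwarz–Pick gives `|φ'| = (1 - |φ|²) / (1 - t²)`. The factor `1 - |φ|` cancels the denominator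
  -- of the hypothesis, and `1 + |φ| ≤ 2` produces the constant `2`.
  have hbound : ∀ t ∈ Set.Ico 0 T, ‖fderiv ℝ f (φ t) (φ' t)‖ ≤ 2 * C / (1 - t ^ 2) := by
    intro t ht'
    have ht := Set.Ico_subset_Icc_self ht'
    have hne := norm_pos_iff.2 (one_add_conj_mul_ne_zero hz (htu1 t ht))
    have hφ1 : ‖φ t‖ < 1 := mem_unitDisk.1 (hφmem t ht)
    have hz2 : 0 < 1 - ‖z‖ ^ 2 := by nlinarith [norm_nonneg z]
    have ht2 : 0 < 1 - t ^ 2 := by nlinarith [ht.1, ht.2]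
    have hsp := one_sub_norm_sq_moebius hz (htu1 t ht)
    rw [htu t ht] at hsp
    have hφ'n : ‖φ' t‖ = (1 - ‖φ t‖ ^ 2) / (1 - t ^ 2) := by
      rw [hφ]
      simp only
      rw [hsp, hφ', norm_div, norm_mul, hu1, one_mul, Complex.norm_of_nonneg hz2.le, norm_pow]
      field_simp
    calc ‖fderiv ℝ f (φ t) (φ' t)‖ ≤ bigLambda f (φ t) * ‖φ' t‖ :=
          norm_fderiv_le_bigLambda_mul _ _ _
      _ ≤ C / (1 - ‖φ t‖) * ‖φ' t‖ := by
          gcongr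
          exact hC _ (hφmem t ht)
      _ = C * (1 + ‖φ t‖) / (1 - t ^ 2) := by
          rw [hφ'n]
          have : 1 - ‖φ t‖ ≠ 0 := by linarith
          field_simp
          ring
      _ ≤ 2 * C / (1 - t ^ 2) := by
          refine div_le_div_of_nonneg_right ?_ ht2.le
          nlinarith [mul_nonneg hC0 (sub_nonneg.2 hφ1.le)]
  have key := image_norm_le_of_norm_deriv_right_le_deriv_boundary'
    (fun t ht => (hFd t ht).continuousAt.continuousWithinAt)
    (fun t ht => (hFd t (Set.Ico_subset_Icc_self ht)).hasDerivWithinAt)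
    (by simp [hφ])
    (fun t ht => (hBd t ht).continuousAt.continuousWithinAt)
    (fun t ht => (hBd t (Set.Ico_subset_Icc_self ht)).hasDerivWithinAt) hbound
    (Set.right_mem_Icc.2 hT0)
  have hφT : φ T = w := by
    have h1 : 1 - conj z * w ≠ 0 := by
      have := one_add_conj_mul_ne_zero (z := -z) (m := w) (by simpa using hz) hw
      rwa [map_neg, neg_mul, ← sub_eq_add_neg] at this
    have h2 : 1 + conj z * m ≠ 0 := one_add_conj_mul_ne_zero hz hT1
    simp only [hφ, hum]
    rw [div_eq_iff h2]
    linear_combination (div_mul_cancel₀ (w - z) h1 : m * (1 - conj z * w) = w - z)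
  rw [hφT, norm_sub_rev] at key
  refine key.trans_eq ?_
  rw [hypDist, hTeq, Real.log_div (by linarith) (by linarith)]
  ring

/-! ### Power series and the coefficient estimate; the Bloch bound. -/

theorem eball_zero_one : Metric.eball (0 : ℂ) 1 = unitDisk := by
  rw [unitDisk, ← ENNReal.ofReal_one, Metric.eball_ofReal]

/-- Convergence at each real `r < 1` already forces the radius of convergence to be at least `1`. -/
theorem hasFPowerSeriesOnBall_tsum {d : ℕ → ℂ}
    (hd : ∀ z ∈ unitDisk, Summable fun n => d n * z ^ n) :
    HasFPowerSeriesOnBall (fun z => ∑' n, d n * z ^ n)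
      (FormalMultilinearSeries.ofScalars ℂ d) 0 1 where
  r_le := by
    refine ENNReal.le_of_forall_nnreal_lt fun r hr => ?_
    have hr1 : (r : ℝ) < 1 := by exact_mod_cast hr
    refine FormalMultilinearSeries.le_radius_of_summable_norm _ ?_
    have h := (hd (r : ℝ) (mem_unitDisk.2 (by simpa using hr1))).norm
    simpa [FormalMultilinearSeries.ofScalars_norm] using h
  r_pos := one_pos
  hasSum := by
    intro y hy
    have hy1 : y ∈ unitDisk := by
      rw [mem_unitDisk]
      simpa [Metric.mem_eball, edist_zero_right, ← ofReal_norm, ENNReal.ofReal_lt_one] using hy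
    simpa [FormalMultilinearSeries.ofScalars_apply_eq, mul_comm] using (hd y hy1).hasSum

theorem coeff_eq_iteratedDeriv_div {q : ℂ → ℂ} {d : ℕ → ℂ}
    (hq : HasFPowerSeriesAt q (FormalMultilinearSeries.ofScalars ℂ d) 0) (n : ℕ) :
    d n = iteratedDeriv n q 0 / n.factorial := by
  have h := hq.eq_formalMultilinearSeries hq.analyticAt.hasFPowerSeriesAt
  rw [FormalMultilinearSeries.ofScalars_series_eq_iff] at h
  exact congrFun h n

/-- Cauchy's estimate for the coefficients of a power series, in terms of the mean modulus of the
derivative. -/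
theorem succ_mul_norm_coeff_mul_pow_le {q : ℂ → ℂ} {d : ℕ → ℂ}
    (hq : HasFPowerSeriesOnBall q (FormalMultilinearSeries.ofScalars ℂ d) 0 1) {r : ℝ}
    (hr0 : 0 < r) (hr1 : r < 1) (k : ℕ) :
    (k + 1) * ‖d (k + 1)‖ * r ^ k ≤
      (2 * Real.pi)⁻¹ * ∫ θ in (0 : ℝ)..(2 * Real.pi),
        ‖deriv q (r * Complex.exp (θ * Complex.I))‖ := by
  have hqd : DifferentiableOn ℂ q unitDisk := by
    have h := hq.differentiableOn
    rwa [eball_zero_one] at h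
  have hdd : DifferentiableOn ℂ (deriv q) unitDisk := hqd.deriv isOpen_unitDisk
  have h1 : AnalyticAt ℂ (deriv q) 0 :=
    hdd.analyticAt (isOpen_unitDisk.mem_nhds (by simp [mem_unitDisk]))
  lift r to NNReal using hr0.le
  have h2 := (hdd.mono (s := Metric.closedBall 0 (r : ℝ)) fun z hz =>
    mem_unitDisk.2 ((mem_closedBall_zero_iff.1 hz).trans_lt hr1)).hasFPowerSeriesOnBall
      (by exact_mod_cast hr0)
  have h3 := h2.hasFPowerSeriesAt.eq_formalMultilinearSeries h1.hasFPowerSeriesAt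
  have h4 := norm_cauchyPowerSeries_le (deriv q) 0 r k
  rw [h3, FormalMultilinearSeries.ofScalars_norm, abs_of_pos hr0] at h4
  -- The `k`-th Taylor coefficient of `q'` is `(k + 1) d_{k+1}`.
  have h5 : ‖iteratedDeriv k (deriv q) 0 / (k.factorial : ℂ)‖ = (k + 1) * ‖d (k + 1)‖ := by
    rw [coeff_eq_iteratedDeriv_div hq.hasFPowerSeriesAt, iteratedDeriv_succ']
    simp only [norm_div, Nat.factorial_succ, Complex.norm_natCast]
    push_cast
    field_simp
  rw [h5] at h4
  calc _ ≤ _ := mul_le_mul_of_nonneg_right h4 (pow_nonneg hr0.le k)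
    _ = _ := by
      rw [mul_assoc, ← mul_pow, inv_mul_cancel₀ hr0.ne', one_pow, mul_one]
      simp [circleMap]

theorem dz_dzbar_eq_of_eq_add_conj {f h g : ℂ → ℂ} (hh : DifferentiableOn ℂ h unitDisk)
    (hg : DifferentiableOn ℂ g unitDisk) (hf : ∀ z ∈ unitDisk, f z = h z + conj (g z)) {z : ℂ}
    (hz : z ∈ unitDisk) : dz f z = deriv h z ∧ dzbar f z = conj (deriv g z) := by
  have hnhds := isOpen_unitDisk.mem_nhds hz
  have h1 := (hh.differentiableAt hnhds).hasDerivAt.hasFDerivAt.restrictScalars ℝ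
  have h2 := (hg.differentiableAt hnhds).hasDerivAt.hasFDerivAt.restrictScalars ℝ
  have h3 := (Complex.conjCLE.toContinuousLinearMap.hasFDerivAt (x := g z)).comp z h2
  have h4 : HasFDerivAt f _ z := (h1.add h3).congr_of_eventuallyEq
    (Filter.eventually_of_mem hnhds fun w hw => hf w hw)
  have e : ∀ v, fderiv ℝ f z v = v * deriv h z + conj (v * deriv g z) := by
    intro v
    rw [h4.fderiv]
    simp
  constructor
  · rw [dz, e, e]
    simp only [map_mul, Complex.conj_I, map_one]
    linear_combination (conj (deriv g z) - deriv h z) / 2 * Complex.I_sq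
  · rw [dzbar, e, e]
    simp only [map_mul, Complex.conj_I, map_one]
    linear_combination (deriv h z - conj (deriv g z)) / 2 * Complex.I_sq

/-- Pointwise, `Λ_f ≤ K (|f_z| - |f_{z̄}|) ≤ K |f_z - e^{-2iθ} f_{z̄}|`. -/
theorem integral_bigLambda_le {K : ℝ} {f : ℂ → ℂ} (hf : IsQuasiconformalHarmonic K f) {r : ℝ}
    (hr0 : 0 < r) (hr1 : r < 1) :
    r * ∫ θ in (0 : ℝ)..(2 * Real.pi), bigLambda f (r * Complex.exp (θ * Complex.I)) ≤
      K * circleLength f r := by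
  have hmem : ∀ θ : ℝ, (r : ℂ) * Complex.exp (θ * Complex.I) ∈ unitDisk := fun θ => by
    rw [mem_unitDisk, norm_ofReal_mul_exp hr0.le]; exact hr1
  have hcirc : Continuous (fun θ : ℝ => (r : ℂ) * Complex.exp (θ * Complex.I)) := by fun_prop
  have h1 := hf.harmonic.continuousOn_dz.comp_continuous hcirc hmem
  have h2 := hf.harmonic.continuousOn_dzbar.comp_continuous hcirc hmem
  have hK : 0 ≤ K := zero_le_one.trans hf.one_le
  rw [circleLength, mul_left_comm, ← intervalIntegral.integral_const_mul K]
  refine mul_le_mul_of_nonneg_left ?_ hr0.le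
  refine intervalIntegral.integral_mono_on Real.two_pi_pos.le
    (Continuous.intervalIntegrable (by unfold bigLambda; fun_prop) _ _)
    (Continuous.intervalIntegrable (by fun_prop) _ _) fun θ _ => ?_
  refine (hf.quasiregular _ (hmem θ)).trans ?_
  rw [smallLambda, abs_of_pos (sub_pos.2 (hf.sensePreserving.norm_dzbar_lt (hmem θ)))]
  gcongr
  exact norm_dz_sub_norm_dzbar_le f _ θ

theorem IsQuasiconformalHarmonic.norm_coeff_add_le {K : ℝ} {f : ℂ → ℂ}
    (hf : IsQuasiconformalHarmonic K f) (hb : boundaryLength f < ⊤) {a b : ℕ → ℂ}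
    (hab : HasHarmonicExpansion f a b) {n : ℕ} (hn : 1 ≤ n) :
    ‖a n‖ + ‖b n‖ ≤ K * (boundaryLength f).toReal / (2 * (n : ℝ) * Real.pi) := by
  obtain ⟨k, rfl⟩ : ∃ k, n = k + 1 := ⟨n - 1, by omega⟩
  have hK : 0 ≤ K := zero_le_one.trans hf.one_le
  have hpi := Real.pi_pos
  -- The value `b 0` is arbitrary in the expansion; setting it to `0` makes the antiholomorphic part
  -- the conjugate of a full power series.
  set b' : ℕ → ℂ := fun n => if n = 0 then 0 else b n with hb'
  have hbs : ∀ z ∈ unitDisk, Summable fun n => b' n * z ^ n := by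
    intro z hz
    rw [← summable_nat_add_iff 1]
    have h := (Complex.conjCLE.toContinuousLinearMap.summable (hab z hz).2.1)
    simpa [hb'] using h
  have hbsum : ∀ z ∈ unitDisk, conj (∑' n, b' n * z ^ n) =
      ∑' n : ℕ, conj (b (n + 1)) * conj z ^ (n + 1) := by
    intro z hz
    rw [(hbs z hz).tsum_eq_zero_add, map_add, Complex.conj_tsum]
    simp [hb']
  have hH := hasFPowerSeriesOnBall_tsum fun z hz => (hab z hz).1
  have hG := hasFPowerSeriesOnBall_tsum hbs
  have hHd := hH.differentiableOn
  have hGd := hG.differentiableOn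
  rw [eball_zero_one] at hHd hGd
  have hder : ∀ z ∈ unitDisk, _ := fun z hz => dz_dzbar_eq_of_eq_add_conj (f := f) hHd hGd
    (fun w hw => by rw [hbsum w hw]; exact (hab w hw).2.2) hz
  -- Here `c` aligns the two coefficients, so Cauchy's estimate for `h + c g`, where `f = h + conj
  -- g`, controls the sum of their moduli.
  obtain ⟨c, hc1, hc2⟩ := exists_norm_eq_one_norm_add_mul (a (k + 1)) (b (k + 1))
  have hq := hH.add (hG.const_smul (c := c))
  rw [← FormalMultilinearSeries.ofScalars_smul, ← FormalMultilinearSeries.ofScalars_add] at hq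
  have hcoef : ‖(a + c • b') (k + 1)‖ = ‖a (k + 1)‖ + ‖b (k + 1)‖ := by
    rw [← hc2]
    simp [hb']
  have hest : ∀ r : ℝ, 0 < r → r < 1 →
      (k + 1) * (‖a (k + 1)‖ + ‖b (k + 1)‖) * r ^ (k + 1) ≤
        (2 * Real.pi)⁻¹ * (K * (boundaryLength f).toReal) := by
    intro r hr0 hr1
    have hmem : ∀ θ : ℝ, (r : ℂ) * Complex.exp (θ * Complex.I) ∈ unitDisk := fun θ => by
      rw [mem_unitDisk, norm_ofReal_mul_exp hr0.le]; exact hr1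
    have hcirc : Continuous (fun θ : ℝ => (r : ℂ) * Complex.exp (θ * Complex.I)) := by fun_prop
    have h1 := hf.harmonic.continuousOn_dz.comp_continuous hcirc hmem
    have h2 := hf.harmonic.continuousOn_dzbar.comp_continuous hcirc hmem
    have h := succ_mul_norm_coeff_mul_pow_le hq hr0 hr1 k
    rw [hcoef] at h
    have hint : ∫ θ in (0 : ℝ)..(2 * Real.pi),
        ‖deriv ((fun z => ∑' n, a n * z ^ n) + c • fun z => ∑' n, b' n * z ^ n)
          (r * Complex.exp (θ * Complex.I))‖ ≤
        ∫ θ in (0 : ℝ)..(2 * Real.pi), bigLambda f (r * Complex.exp (θ * Complex.I)) := by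
      have hd : ∀ z ∈ unitDisk,
          deriv ((fun z => ∑' n, a n * z ^ n) + c • fun z => ∑' n, b' n * z ^ n) z =
            dz f z + c * conj (dzbar f z) := by
        intro z hz
        have hnhds := isOpen_unitDisk.mem_nhds hz
        rw [deriv_add (hHd.differentiableAt hnhds) ((hGd.differentiableAt hnhds).const_smul c),
          deriv_const_smul_field, (hder z hz).1, (hder z hz).2, Complex.conj_conj, smul_eq_mul]
      simp_rw [fun θ : ℝ => hd _ (hmem θ)]
      refine intervalIntegral.integral_mono_on Real.two_pi_pos.le
        (Continuous.intervalIntegrable (by fun_prop) _ _)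
        (Continuous.intervalIntegrable (by unfold bigLambda; fun_prop) _ _) fun θ _ => ?_
      refine (norm_add_le _ _).trans_eq ?_
      rw [norm_mul, hc1, one_mul, RCLike.norm_conj, bigLambda]
    calc (k + 1) * (‖a (k + 1)‖ + ‖b (k + 1)‖) * r ^ (k + 1)
        = r * ((k + 1) * (‖a (k + 1)‖ + ‖b (k + 1)‖) * r ^ k) := by ring
      _ ≤ r * ((2 * Real.pi)⁻¹ *
          ∫ θ in (0 : ℝ)..(2 * Real.pi), bigLambda f (r * Complex.exp (θ * Complex.I))) := by
        refine mul_le_mul_of_nonneg_left (h.trans ?_) hr0.le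
        gcongr
      _ = (2 * Real.pi)⁻¹ * (r *
          ∫ θ in (0 : ℝ)..(2 * Real.pi), bigLambda f (r * Complex.exp (θ * Complex.I))) := by ring
      _ ≤ (2 * Real.pi)⁻¹ * (K * (boundaryLength f).toReal) := by
        refine mul_le_mul_of_nonneg_left ((integral_bigLambda_le hf hr0 hr1).trans ?_) (by positivity)
        exact mul_le_mul_of_nonneg_left (circleLength_le_toReal_boundaryLength hb hr0 hr1) hK
  have hlim : Filter.Tendsto (fun r : ℝ => (k + 1) * (‖a (k + 1)‖ + ‖b (k + 1)‖) * r ^ (k + 1))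
      (nhdsWithin 1 (Set.Iio 1)) (nhds ((k + 1) * (‖a (k + 1)‖ + ‖b (k + 1)‖) * 1 ^ (k + 1))) :=
    (Continuous.tendsto (by fun_prop) _).mono_left nhdsWithin_le_nhds
  have hfin := le_of_tendsto hlim (by
    filter_upwards [Ioo_mem_nhdsLT one_pos] with r hr
    exact hest r hr.1 hr.2)
  rw [one_pow, mul_one] at hfin
  rw [le_div_iff₀ (by positivity)]
  push_cast
  calc _ = (2 * Real.pi) * ((k + 1) * (‖a (k + 1)‖ + ‖b (k + 1)‖)) := by ring
    _ ≤ (2 * Real.pi) * ((2 * Real.pi)⁻¹ * (K * (boundaryLength f).toReal)) := by gcongr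
    _ = _ := by field_simp

theorem IsQuasiconformalHarmonic.lipschitzNumber_le {K : ℝ} {f : ℂ → ℂ}
    (hf : IsQuasiconformalHarmonic K f) (hb : boundaryLength f < ⊤) :
    lipschitzNumber f ≤
      ENNReal.ofReal ((boundaryLength f).toReal * Real.sqrt K / Real.pi) := by
  have hpi := Real.pi_pos
  refine iSup₂_le fun z hz => iSup₂_le fun w hw => iSup_le fun _ => ENNReal.ofReal_le_ofReal ?_
  refine div_le_of_le_mul₀ (hypDist_nonneg hz hw) (by positivity) ?_
  have h := norm_sub_le_mul_hypDist
    (C := (boundaryLength f).toReal * Real.sqrt K / (2 * Real.pi))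
    (fun z hz => (hf.harmonic.contDiffAt hz).differentiableAt two_ne_zero)
    (fun z hz => (hf.bigLambda_le hb hz).trans_eq (by rw [div_div])) hz hw
  refine h.trans_eq ?_
  field_simp

/-! ### The extremal example: the identity. -/

theorem dz_id (z : ℂ) : dz (fun z => z) z = 1 := by
  simp [dz]

theorem dzbar_id (z : ℂ) : dzbar (fun z => z) z = 0 := by
  simp [dzbar]

theorem circleLength_id (r : ℝ) : circleLength (fun z => z) r = r * (2 * Real.pi) := by
  simp [circleLength, dz_id, dzbar_id]

/-- The supremum over `r < 1` is not attained, only approached as `r → 1`, so the lower bound needs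
a limit. -/
theorem boundaryLength_id : boundaryLength (fun z => z) = ENNReal.ofReal (2 * Real.pi) := by
  have hpi := Real.pi_pos
  refine le_antisymm (iSup₂_le fun r hr => ENNReal.ofReal_le_ofReal ?_) ?_
  · rw [circleLength_id]
    nlinarith [hr.2]
  · have hlim : Filter.Tendsto (fun r : ℝ => ENNReal.ofReal (circleLength (fun z => z) r))
        (nhdsWithin 1 (Set.Iio 1)) (nhds (ENNReal.ofReal (1 * (2 * Real.pi)))) := by
      simp_rw [circleLength_id]
      exact (Continuous.tendsto (ENNReal.continuous_ofReal.comp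
        (continuous_id.mul continuous_const)) _).mono_left nhdsWithin_le_nhds
    rw [one_mul] at hlim
    refine le_of_tendsto hlim ?_
    filter_upwards [Ioo_mem_nhdsLT one_pos] with r hr
    exact le_iSup₂ (f := fun r (_ : r ∈ Set.Ioo (0 : ℝ) 1) =>
      ENNReal.ofReal (circleLength (fun z => z) r)) r hr

theorem isQuasiconformalHarmonic_id : IsQuasiconformalHarmonic 1 (fun z : ℂ => z) where
  one_le := le_rfl
  harmonic := ⟨fun z _ => (analyticAt_id (𝕜 := ℂ) (z := z)).harmonicAt_re,
    fun z _ => (analyticAt_id (𝕜 := ℂ) (z := z)).harmonicAt_im⟩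
  sensePreserving := fun z _ => by simp [jacobian, dz_id, dzbar_id]
  quasiregular := fun z _ => by simp [bigLambda, smallLambda, dz_id, dzbar_id]
  univalent := Function.injective_id.injOn

theorem hasHarmonicExpansion_id :
    HasHarmonicExpansion (fun z : ℂ => z) (fun n => if n = 1 then 1 else 0) 0 := by
  intro z _
  have h : HasSum (fun n : ℕ => (if n = 1 then (1 : ℂ) else 0) * z ^ n) z := by
    have := hasSum_single (f := fun n : ℕ => (if n = 1 then (1 : ℂ) else 0) * z ^ n) 1
      (fun n hn => by simp [hn])
    simpa using this
  refine ⟨h.summable, by simp [summable_zero], ?_⟩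
  rw [h.tsum_eq]
  simp

end PlanarHarmonic

end

theorem theorem3 :
    (∀ (K : ℝ) (f : ℂ → ℂ), PlanarHarmonic.IsQuasiconformalHarmonic K f →
      PlanarHarmonic.boundaryLength f < ⊤ →
        (∀ a b : ℕ → ℂ, PlanarHarmonic.HasHarmonicExpansion f a b → ∀ n : ℕ, 1 ≤ n →
          ‖a n‖ + ‖b n‖ ≤
            K * (PlanarHarmonic.boundaryLength f).toReal / (2 * (n : ℝ) * Real.pi)) ∧
        (∀ z ∈ PlanarHarmonic.unitDisk,
          PlanarHarmonic.bigLambda f z ≤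
            (PlanarHarmonic.boundaryLength f).toReal * Real.sqrt K /
              (2 * Real.pi * (1 - ‖z‖))) ∧
        PlanarHarmonic.IsHarmonicBloch f ∧
        PlanarHarmonic.lipschitzNumber f ≤
          ENNReal.ofReal ((PlanarHarmonic.boundaryLength f).toReal * Real.sqrt K / Real.pi)) ∧
    -- sharpness for `K = 1`: the identity is admissible and attains both estimates,
    -- the first one at `n = 1`, the second one at `z = 0`
    (PlanarHarmonic.IsQuasiconformalHarmonic 1 (fun z : ℂ => z) ∧
      PlanarHarmonic.boundaryLength (fun z : ℂ => z) < ⊤ ∧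
      (∃ a b : ℕ → ℂ, PlanarHarmonic.HasHarmonicExpansion (fun z : ℂ => z) a b ∧
        ‖a 1‖ + ‖b 1‖ =
          1 * (PlanarHarmonic.boundaryLength (fun z : ℂ => z)).toReal /
            (2 * ((1 : ℕ) : ℝ) * Real.pi)) ∧
      PlanarHarmonic.bigLambda (fun z : ℂ => z) 0 =
        (PlanarHarmonic.boundaryLength (fun z : ℂ => z)).toReal * Real.sqrt 1 /
          (2 * Real.pi * (1 - ‖(0 : ℂ)‖))) := by
  open PlanarHarmonic in
  refine ⟨fun K f hf hb => ⟨fun a b hab n hn => hf.norm_coeff_add_le hb hab hn,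
    fun z hz => hf.bigLambda_le hb hz,
    ⟨hf.harmonic, (hf.lipschitzNumber_le hb).trans_lt ENNReal.ofReal_lt_top⟩,
    hf.lipschitzNumber_le hb⟩, isQuasiconformalHarmonic_id, ?_,
    ⟨_, _, hasHarmonicExpansion_id, ?_⟩, ?_⟩
  · rw [PlanarHarmonic.boundaryLength_id]
    exact ENNReal.ofReal_lt_top
  · rw [PlanarHarmonic.boundaryLength_id, ENNReal.toReal_ofReal Real.two_pi_pos.le]
    simp
  · rw [PlanarHarmonic.boundaryLength_id, ENNReal.toReal_ofReal Real.two_pi_pos.le]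
    simp [PlanarHarmonic.bigLambda, PlanarHarmonic.dz_id, PlanarHarmonic.dzbar_id]
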